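/- An \emph{interval $t$-coloring} of a finite simple graph $G$ is a proper edge-coloring of $G$ with colors $1,2,\ldots,t$ in which all $t$ colors are used and, for every vertex $v$, the set of colors of the edges incident to $v$ is an interval of consecutive integers. Let $W(G)$ denote the greatest $t$ for which $G$ has an interval $t$-coloring. For $n = 1,2,\ldots,12$, the complete graph $K_{2n}$ has an interval $t$-coloring with, respectively, $$t = 1,\ 4,\ 7,\ 11,\ 14,\ 18,\ 21,\ 26,\ 29,\ 33,\ 37,\ 41,$$ and has no interval $t$-coloring for any larger $t$; that is, $W(K_{2n})$ equals the $n$-th number of this list. In particular $W(K_{22}) = 37$. For a positive integer $n$ let $\|n_2\|$ be the number of $1$'s in the binary representation of $n$. Since $4n-2-\lfloor\log_2 n\rfloor-\|n_2\| = 36$ for $n = 11$, the conjecture that $W(K_{2n}) = 4n-2-\lfloor\log_2 n\rfloor-\|n_2\|$ for every positive integer $n$ is false. -/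

import Mathlib

namespace IntervalColoring

/-- The spectrum of the vertex `v`: the set of colors of the edges incident to `v`. -/
def spectrum {V : Type*} {G : SimpleGraph V} (c : G.EdgeLabeling ℕ) (v : V) : Set ℕ :=
  {k | ∃ e : G.edgeSet, v ∈ (e : Sym2 V) ∧ c e = k}

/-- `c` is a proper edge-coloring with colors `1, …, t`, all of which are used, such that
the spectrum of every vertex is an interval of integers (the empty set counts as an interval;
it occurs only as the spectrum of an isolated vertex). -/
structure IsIntervalColoring {V : Type*} {G : SimpleGraph V} (c : G.EdgeLabeling ℕ) (t : ℕ) :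
    Prop where
  proper : ∀ e f : G.edgeSet, e ≠ f →
    (∃ v : V, v ∈ (e : Sym2 V) ∧ v ∈ (f : Sym2 V)) → c e ≠ c f
  range_eq : Set.range c = Set.Icc 1 t
  interval : ∀ v : V, ∃ a b : ℕ, spectrum c v = Set.Icc a b

/-- The set of all `t` for which `G` has an interval `t`-coloring. -/
def colorCounts {V : Type*} (G : SimpleGraph V) : Set ℕ :=
  {t | ∃ c : G.EdgeLabeling ℕ, IsIntervalColoring c t}

/-- `W(G)`, the greatest `t` for which `G` has an interval `t`-coloring
(meaningful when `colorCounts G` has a greatest element). -/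
noncomputable def W {V : Type*} (G : SimpleGraph V) : ℕ :=
  sSup (colorCounts G)

/-- The complete graph `K_m`. -/
abbrev K (m : ℕ) : SimpleGraph (Fin m) := ⊤

/-- The conjectured value `4n - 2 - ⌊log₂ n⌋ - ‖n₂‖` of `W(K_{2n})`, where `‖n₂‖` is the number
of ones in the binary representation of `n`. -/
def conjecturedValue (n : ℕ) : ℤ :=
  4 * (n : ℤ) - 2 - (Nat.log 2 n : ℤ) - ((Nat.digits 2 n).count 1 : ℤ)

end IntervalColoring

/-! In an interval coloring of `K (2 * n)` the spectrum of `v` is `s v + 1, …, s v + r` with `r = 2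
* n - 1`, and `min s = 0`, so the number of colors is `r + T` with `T = max s`. The task is to bound
`T`. Modulo `r` the colors split the edges into `r` perfect matchings. An edge of residue `k` has
color `k` or `k + r`, according to whether its ends lie in `S_k = {v | s v < k}` or not. So the
`k`-th matching never leaves `S_k`, and `|S_k| = 2 j_k` is even. Let `L` be `2 i` vertices of
smallest shift. As `L` and `S_k` are nested, the `k`-th matching has at most `2 |i - j_k|` edges
leaving `L`. Counting all `4 i (n - i)` such edges limits how many `j_k` can be close to `i`
(`sum_weight_le`). For `1 ≤ k ≤ T` one has `1 ≤ j_k ≤ n - 1`, so `T` is bounded by a packing linear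
program, hence by any dual feasible vector (`mul_shift_le`). For `n ≤ 12` explicit dual vectors and
explicit colorings meet; at `n = 11` the value exceeds the conjectured one. -/

namespace IntervalColoring

/-- A symmetric function `f`, read as an edge-coloring of the complete graph on `V`, such that
the edges at `u` bijectively receive the colors `s u + 1, …, s u + r`. -/
structure IsShiftColoring {V : Type*} (f : V → V → ℕ) (s : V → ℕ) (r : ℕ) : Prop where
  symm : ∀ u v, f u v = f v u
  inj : ∀ u v w, v ≠ u → w ≠ u → f u v = f u w → v = w
  lower : ∀ u v, v ≠ u → s u < f u v
  upper : ∀ u v, v ≠ u → f u v ≤ s u + r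
  surj : ∀ u k, s u < k → k ≤ s u + r → ∃ v, v ≠ u ∧ f u v = k

/-- Every `a ≤ |V|` is the size of an initial segment of `V` ordered by `s`. -/
theorem exists_initial_finset {V : Type*} [Fintype V] [DecidableEq V] (s : V → ℕ) (a : ℕ)
    (ha : a ≤ Fintype.card V) :
    ∃ L : Finset V, L.card = a ∧ ∀ u ∈ L, ∀ v ∉ L, s u ≤ s v := by
  induction a with
  | zero => exact ⟨∅, by simp⟩
  | succ a ih =>
    obtain ⟨L, hL, hs⟩ := ih (by omega)
    have hne : (Finset.univ \ L).Nonempty := by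
      rw [← Finset.card_pos, Finset.card_univ_sdiff]; omega
    obtain ⟨x, hx, hmin⟩ := Finset.exists_min_image _ s hne
    have hxL : x ∉ L := by simpa using hx
    refine ⟨insert x L, by simp [hxL, hL], fun u hu v hv => ?_⟩
    simp only [Finset.mem_insert, not_or] at hu hv
    rcases hu with rfl | hu
    · exact hmin v (by simpa using hv.2)
    · exact hs u hu v hv.2

/-! ### Residue classes of colors as matchings -/

namespace IsShiftColoring

variable {V : Type*} {f : V → V → ℕ} {s : V → ℕ} {r : ℕ}

/-- The edge from `u` to `u₀` has a color above `s u` and at most `r`. Hence all colors are below `2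
* r`, the range where `residue` is meaningful. -/
theorem shift_lt (h : IsShiftColoring f s r) (hr : 1 ≤ r) {u₀ : V} (h₀ : s u₀ = 0) (u : V) :
    s u < r := by
  by_cases hu : u = u₀
  · subst hu; omega
  · have h1 := h.lower u u₀ (Ne.symm hu)
    have h2 := h.upper u₀ u hu
    rw [h.symm] at h1
    omega

/-- The residue of a color modulo `r`, normalized to `1, …, r` for colors in `1, …, 2 r`. -/
def residue (r x : ℕ) : ℕ := if x ≤ r then x else x - r

theorem residue_inj (h : IsShiftColoring f s r) {u v w : V} (hv : v ≠ u) (hw : w ≠ u)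
    (hs : ∀ u, s u < r) (e : residue r (f u v) = residue r (f u w)) : v = w := by
  have h1 := h.lower u v hv
  have h2 := h.upper u v hv
  have h3 := h.lower u w hw
  have h4 := h.upper u w hw
  have := hs u
  refine h.inj u v w hv hw ?_
  unfold residue at e
  split_ifs at e <;> omega

/-- With `k` the residue, either side says that the color is `k` rather than `k + r`, and the two
ends share that color. -/
theorem shift_lt_iff (h : IsShiftColoring f s r) {u v : V} (hv : v ≠ u)
    (hs : ∀ u, s u < r) : s u < residue r (f u v) ↔ s v < residue r (f u v) := by
  have h1 := h.lower u v hv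
  have h2 := h.upper u v hv
  have h3 := h.lower v u hv.symm
  have h4 := h.upper v u hv.symm
  rw [h.symm v u] at h3 h4
  have := hs u
  have := hs v
  unfold residue
  split_ifs <;> omega

variable [Fintype V]

/-- The edges of color exactly `k` form a perfect matching of this set: each of its vertices sees
`k`, and so does its partner, whose shift is then also below `k`. -/
theorem even_card_shift_lt (h : IsShiftColoring f s r) {k : ℕ} (hk : k ≤ r) :
    Even (Finset.univ.filter fun v => s v < k).card := by
  have H : ∀ v, s v < k → ∃ w, w ≠ v ∧ f v w = k := fun v hv => h.surj v k hv (by omega)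
  choose! p hne hp using H
  have hlt : ∀ v, s v < k → s (p v) < k := fun v hv => by
    have := h.lower (p v) v (hne v hv).symm
    rwa [h.symm, hp v hv] at this
  have hinv : ∀ v, s v < k → p (p v) = v := fun v hv => by
    refine h.inj (p v) _ _ (hne _ (hlt v hv)) (hne v hv).symm ?_
    rw [hp _ (hlt v hv), h.symm, hp v hv]
  rw [← ZMod.natCast_eq_zero_iff_even, Finset.card_eq_sum_ones, Nat.cast_sum]
  refine Finset.sum_involution (fun v _ => p v) (fun _ _ => by decide)
    (fun v hv _ => hne v (Finset.mem_filter.1 hv).2)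
    (fun v hv => Finset.mem_filter.2 ⟨Finset.mem_univ _, hlt v (Finset.mem_filter.1 hv).2⟩)
    (fun v hv => hinv v (Finset.mem_filter.1 hv).2)

/-! ### Edges leaving an initial segment -/

variable [DecidableEq V]

/-- The edges between `L` and its complement with color residue `k`. -/
def crossing (f : V → V → ℕ) (r : ℕ) (L : Finset V) (k : ℕ) : Finset (V × V) :=
  (L ×ˢ Lᶜ).filter fun e => residue r (f e.1 e.2) = k

theorem mem_crossing {L : Finset V} {k : ℕ} {u v : V} :
    (u, v) ∈ crossing f r L k ↔ (u ∈ L ∧ v ∉ L) ∧ residue r (f u v) = k := by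
  simp [crossing]

theorem sum_card_crossing (h : IsShiftColoring f s r) (hs : ∀ u, s u < r) (L : Finset V) :
    ∑ k ∈ Finset.Icc 1 r, (crossing f r L k).card = L.card * Lᶜ.card := by
  rw [← Finset.card_product]
  refine (Finset.card_eq_sum_card_fiberwise fun e he => ?_).symm
  obtain ⟨u, v⟩ := e
  have hm : u ∈ L ∧ v ∉ L := by simpa using he
  have hne : v ≠ u := fun e => hm.2 (e ▸ hm.1)
  have h1 := h.lower u v hne
  have h2 := h.upper u v hne
  have := hs u
  simp only [residue, Finset.coe_Icc, Set.mem_Icc]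
  split_ifs <;> omega

/-- A residue class is a matching, so an edge in it is determined by its end in `L`. -/
theorem card_crossing_le_left (h : IsShiftColoring f s r) (hs : ∀ u, s u < r) {L A : Finset V}
    {k : ℕ} (hA : ∀ u v, (u, v) ∈ crossing f r L k → u ∈ A) :
    (crossing f r L k).card ≤ A.card := by
  refine Finset.card_le_card_of_injOn Prod.fst (fun e he => hA e.1 e.2 he) ?_
  rintro ⟨u, v⟩ h1 ⟨u', w⟩ h2 (rfl : u = u')
  have h1 := mem_crossing.1 (Finset.mem_coe.1 h1)
  have h2 := mem_crossing.1 (Finset.mem_coe.1 h2)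
  rw [h.residue_inj (u := u) (v := v) (w := w) (fun e => h1.1.2 (e ▸ h1.1.1))
    (fun e => h2.1.2 (e ▸ h2.1.1)) hs (h1.2.trans h2.2.symm)]

theorem card_crossing_le_right (h : IsShiftColoring f s r) (hs : ∀ u, s u < r) {L A : Finset V}
    {k : ℕ} (hA : ∀ u v, (u, v) ∈ crossing f r L k → v ∈ A) :
    (crossing f r L k).card ≤ A.card := by
  refine Finset.card_le_card_of_injOn Prod.snd (fun e he => hA e.1 e.2 he) ?_
  rintro ⟨v, u⟩ h1 ⟨w, u'⟩ h2 (rfl : u = u')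
  have h1 := mem_crossing.1 (Finset.mem_coe.1 h1)
  have h2 := mem_crossing.1 (Finset.mem_coe.1 h2)
  rw [h.residue_inj (u := u) (v := v) (w := w) (fun e => h1.1.2 (e ▸ h1.1.1))
    (fun e => h2.1.2 (e ▸ h2.1.1)) hs (by rw [h.symm u v, h.symm u w, h1.2, h2.2])]

/-- Both `L` and `S` are initial segments for `s`, hence nested. A crossing edge has its ends both
in `S` or both outside, so one end lies in the difference of the two sets. -/
theorem card_crossing_le_dist (h : IsShiftColoring f s r) (hs : ∀ u, s u < r) {L : Finset V}
    (hL : ∀ u ∈ L, ∀ v ∉ L, s u ≤ s v) (k : ℕ) :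
    (crossing f r L k).card ≤ Nat.dist L.card (Finset.univ.filter fun v => s v < k).card := by
  set S := Finset.univ.filter fun v => s v < k with hS
  have key : ∀ u v, (u, v) ∈ crossing f r L k → u ∈ L ∧ v ∉ L ∧ (u ∈ S ↔ v ∈ S) := by
    intro u v he
    obtain ⟨⟨hu, hv⟩, rfl⟩ := mem_crossing.1 he
    refine ⟨hu, hv, ?_⟩
    simpa [hS] using h.shift_lt_iff (u := u) (v := v) (fun e => hv (e ▸ hu)) hs
  by_cases hsub : L ⊆ S
  · refine (h.card_crossing_le_right hs (A := S \ L) fun u v he => ?_).trans ?_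
    · obtain ⟨hu, hv, hiff⟩ := key u v he
      exact Finset.mem_sdiff.2 ⟨hiff.1 (hsub hu), hv⟩
    · rw [Finset.card_sdiff_of_subset hsub]
      unfold Nat.dist; omega
  · have hsup : S ⊆ L := by
      obtain ⟨x, hx, hxS⟩ := Finset.not_subset.1 hsub
      intro v hv
      by_contra hvL
      have := hL x hx v hvL
      simp only [hS, Finset.mem_filter, Finset.mem_univ, true_and] at hv hxS
      omega
    refine (h.card_crossing_le_left hs (A := L \ S) fun u v he => ?_).trans ?_
    · obtain ⟨hu, hv, hiff⟩ := key u v he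
      exact Finset.mem_sdiff.2 ⟨hu, fun hS => hv (hsup (hiff.1 hS))⟩
    · rw [Finset.card_sdiff_of_subset hsup]
      unfold Nat.dist; omega

/-! ### The packing inequalities and their dual -/

/-- The weight `max(0, h - |i - j|)`, where `h = min(i, n - i)`. -/
def weight (n i j : ℕ) : ℕ := min i (n - i) - Nat.dist i j

/-- The bound `h (2 h - 1)`, where `h = min(i, n - i)`. -/
def capacity (n i : ℕ) : ℕ := min i (n - i) * (2 * min i (n - i) - 1)

/-- Put `m = min i (n - i)`. Each of the `2 * n - 1` classes has at most `2 m` edges leaving `L`,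
and together they have `4 m (n - m)`, so the total deficit is `2 m (2 m - 1)`. Class `k` has deficit
at least twice its weight. -/
theorem sum_weight_le {n T i : ℕ} (h : IsShiftColoring f s (2 * n - 1))
    (hs : ∀ u, s u < 2 * n - 1) (hV : Fintype.card V = 2 * n) (hT : T ≤ 2 * n - 1) (hi : i ≤ n) :
    ∑ k ∈ Finset.Icc 1 T, weight n i ((Finset.univ.filter fun v => s v < k).card / 2) ≤
      capacity n i := by
  obtain ⟨L, hLc, hL⟩ := exists_initial_finset s (2 * i) (by omega)
  have hLc' : Lᶜ.card = 2 * (n - i) := by rw [Finset.card_compl]; omega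
  set m := min i (n - i) with hm
  have h1 : ∀ k ∈ Finset.Icc 1 (2 * n - 1), (crossing f (2 * n - 1) L k).card +
      (if k ≤ T then 2 * weight n i ((Finset.univ.filter fun v => s v < k).card / 2) else 0) ≤
      2 * m := by
    intro k hk
    have a1 := h.card_crossing_le_left hs (L := L) (A := L) (k := k) fun u v he =>
      (mem_crossing.1 he).1.1
    have a2 := h.card_crossing_le_right hs (L := L) (A := Lᶜ) (k := k) fun u v he =>
      Finset.mem_compl.2 (mem_crossing.1 he).1.2
    have a3 := h.card_crossing_le_dist hs hL k
    obtain ⟨j, hj⟩ := h.even_card_shift_lt (Finset.mem_Icc.1 hk).2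
    rw [hj] at a3 ⊢
    unfold weight
    unfold Nat.dist at a3 ⊢
    split_ifs <;> omega
  have h2 := Finset.sum_le_sum h1
  rw [Finset.sum_add_distrib, h.sum_card_crossing hs, hLc, hLc', Finset.sum_const,
    Nat.card_Icc, ← Finset.sum_filter] at h2
  have h3 : (Finset.Icc 1 (2 * n - 1)).filter (· ≤ T) = Finset.Icc 1 T := by
    ext k; simp only [Finset.mem_filter, Finset.mem_Icc]; omega
  rw [h3, ← Finset.mul_sum] at h2
  have h4 : i * (n - i) = m * (n - m) := by
    rcases le_total i (n - i) with hle | hle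
    · rw [hm, min_eq_left hle]
    · rw [hm, min_eq_right hle, mul_comm]; congr 1; omega
  obtain ⟨q, hq⟩ : ∃ q, n = m + q := ⟨n - m, by omega⟩
  rw [capacity, ← hm]
  rw [show 2 * i * (2 * (n - i)) = 4 * (i * (n - i)) by ring, h4, hq, Nat.add_sub_cancel,
    Nat.add_sub_cancel_left, smul_eq_mul, ← hq] at h2
  generalize ∑ k ∈ Finset.Icc 1 T, weight n i _ = w at h2 ⊢
  clear_value m
  -- The case `m = 0` is separate because `2 * m - 1` is truncated there.
  rcases m with _ | x
  · omega
  · rw [hq, show 2 * (x + 1 + q) - 1 = 2 * x + 2 * q + 1 by omega] at h2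
    rw [show 2 * (x + 1) - 1 = 2 * x + 1 by omega]
    nlinarith

/-- Weak duality: a nonnegative combination of the bounds `sum_weight_le` that covers every
`j = 1, …, n - 1` at least `D` times bounds the largest shift. -/
theorem mul_shift_le {n T D : ℕ} (h : IsShiftColoring f s (2 * n - 1)) (hn : 1 ≤ n)
    (hV : Fintype.card V = 2 * n) {u₀ u₁ : V} (h₀ : s u₀ = 0) (h₁ : s u₁ = T) (y : ℕ → ℕ)
    (hy : ∀ j ∈ Finset.Ico 1 n, D ≤ ∑ i ∈ Finset.range n, y i * weight n i j) :
    D * T ≤ ∑ i ∈ Finset.range n, y i * capacity n i := by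
  have hs := h.shift_lt (by omega) h₀
  have hT : T ≤ 2 * n - 1 := h₁ ▸ (hs u₁).le
  calc D * T = ∑ k ∈ Finset.Icc 1 T, D := by simp [mul_comm]
    _ ≤ ∑ k ∈ Finset.Icc 1 T, ∑ i ∈ Finset.range n,
          y i * weight n i ((Finset.univ.filter fun v => s v < k).card / 2) := by
        refine Finset.sum_le_sum fun k hk => hy _ ?_
        rw [Finset.mem_Icc] at hk
        obtain ⟨j, hj⟩ := h.even_card_shift_lt (hk.2.trans hT)
        -- For `1 ≤ k ≤ T` the set contains `u₀` but not `u₁`, so half its size lies strictly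
        -- between `0` and `n`.
        have hpos : 0 < (Finset.univ.filter fun v => s v < k).card :=
          Finset.card_pos.2 ⟨u₀, by simp; omega⟩
        have hlt : (Finset.univ.filter fun v => s v < k).card < Fintype.card V :=
          Finset.card_lt_card (Finset.filter_ssubset.2 ⟨u₁, Finset.mem_univ _, by omega⟩)
        rw [Finset.mem_Ico]
        omega
    _ = ∑ i ∈ Finset.range n, y i * ∑ k ∈ Finset.Icc 1 T,
          weight n i ((Finset.univ.filter fun v => s v < k).card / 2) := by
        rw [Finset.sum_comm]; simp only [Finset.mul_sum]
    _ ≤ _ := Finset.sum_le_sum fun i hi => Nat.mul_le_mul_left _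
        (h.sum_weight_le hs hV hT (Finset.mem_range.1 hi).le)

end IsShiftColoring

/-! ### From interval colorings to shifts -/

section FromEdgeLabeling

variable {m : ℕ} (c : (K m).EdgeLabeling ℕ)

/-- The color of the edge `u v` under `c`, with value `0` on the diagonal. -/
def edgeColor (u v : Fin m) : ℕ := if h : u ≠ v then c.get u v h else 0

variable {c}

theorem edgeColor_comm (u v : Fin m) : edgeColor c u v = edgeColor c v u := by
  unfold edgeColor
  by_cases h : u = v
  · rw [h]
  · rw [dif_pos h, dif_pos (fun e => h e.symm)]
    exact c.get_comm v u _

theorem exists_edgeColor_eq (e : (K m).edgeSet) {v : Fin m} (hv : v ∈ (e : Sym2 (Fin m))) :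
    ∃ u, u ≠ v ∧ edgeColor c v u = c e := by
  obtain ⟨e, he⟩ := e
  obtain ⟨u, rfl⟩ := Sym2.mem_iff_exists.1 hv
  have hne : v ≠ u := by simpa using he
  exact ⟨u, hne.symm, by rw [edgeColor, dif_pos hne]; rfl⟩

theorem edgeColor_eq {u v : Fin m} (h : u ≠ v) :
    edgeColor c u v = c ⟨s(u, v), h⟩ := dif_pos h

theorem spectrum_eq_image (v : Fin m) :
    spectrum c v = edgeColor c v '' {u | u ≠ v} := by
  ext k
  constructor
  · rintro ⟨e, he, rfl⟩
    obtain ⟨u, hu, h⟩ := exists_edgeColor_eq (c := c) e he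
    exact ⟨u, hu, h⟩
  · rintro ⟨u, hu, rfl⟩
    exact ⟨⟨s(v, u), Ne.symm hu⟩, Sym2.mem_mk_left v u, (edgeColor_eq (Ne.symm hu)).symm⟩

theorem IsIntervalColoring.edgeColor_inj {t : ℕ} (h : IsIntervalColoring c t) {u v w : Fin m}
    (hv : v ≠ u) (hw : w ≠ u) (e : edgeColor c u v = edgeColor c u w) : v = w := by
  by_contra hvw
  rw [edgeColor_eq hv.symm, edgeColor_eq hw.symm] at e
  refine h.proper _ _ (fun heq => hvw ?_) ⟨u, Sym2.mem_mk_left u v, Sym2.mem_mk_left u w⟩ e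
  exact Sym2.congr_right.1 (congrArg Subtype.val heq)

theorem IsIntervalColoring.exists_isShiftColoring {t : ℕ} (h : IsIntervalColoring c t)
    (hm : 2 ≤ m) : ∃ s : Fin m → ℕ, IsShiftColoring (edgeColor c) s (m - 1) ∧
      (∃ u, s u = 0) ∧ ∃ u, s u + (m - 1) = t := by
  have hspec : ∀ v, ∃ a, spectrum c v = Set.Icc (a + 1) (a + (m - 1)) := by
    intro v
    obtain ⟨a, b, hab⟩ := h.interval v
    have hcard : (spectrum c v).ncard = m - 1 := by
      rw [spectrum_eq_image, Set.InjOn.ncard_image (s := {u | u ≠ v})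
        fun x hx y hy e => h.edgeColor_inj hx hy e]
      have : {u : Fin m | u ≠ v} = ((Finset.univ.erase v : Finset (Fin m)) : Set (Fin m)) := by
        ext; simp
      rw [this, Set.ncard_coe_finset]
      simp
    have hcard' : b + 1 - a = m - 1 := by
      rw [← hcard, hab, ← Finset.coe_Icc, Set.ncard_coe_finset, Nat.card_Icc]
    -- As `m ≥ 2`, the spectrum is nonempty, so its least element `a` is an actual color.
    have ha : 1 ≤ a := by
      have : a ∈ spectrum c v := by rw [hab, Set.mem_Icc]; omega
      obtain ⟨e, -, he⟩ := this
      have : a ∈ Set.range c := ⟨e, he⟩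
      rw [h.range_eq] at this
      exact this.1
    exact ⟨a - 1, by rw [hab]; congr 1 <;> omega⟩
  choose s hs using hspec
  have hmem : ∀ u v, v ≠ u → edgeColor c u v ∈ Set.Icc (s u + 1) (s u + (m - 1)) := by
    intro u v hv
    rw [← hs, spectrum_eq_image]
    exact ⟨v, hv, rfl⟩
  have ht : ∀ k, 1 ≤ k → k ≤ t → ∃ v, k ∈ Set.Icc (s v + 1) (s v + (m - 1)) := by
    intro k h1 h2
    obtain ⟨e, he⟩ : k ∈ Set.range c := by rw [h.range_eq]; exact ⟨h1, h2⟩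
    obtain ⟨⟨u, v⟩, huv⟩ := e
    exact ⟨u, by rw [← hs]; exact ⟨_, Sym2.mem_mk_left u v, he⟩⟩
  have hle : ∀ v, s v + (m - 1) ≤ t := by
    intro v
    have : s v + (m - 1) ∈ spectrum c v := by rw [hs, Set.mem_Icc]; omega
    obtain ⟨e, -, he⟩ := this
    have : s v + (m - 1) ∈ Set.range c := ⟨e, he⟩
    rw [h.range_eq] at this
    exact this.2
  have ht1 : 1 ≤ t := by have := hle ⟨0, by omega⟩; omega
  refine ⟨s, ⟨edgeColor_comm, fun u v w => h.edgeColor_inj, fun u v hv => (hmem u v hv).1,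
    fun u v hv => (hmem u v hv).2, fun u k h1 h2 => ?_⟩, ?_, ?_⟩
  · have : k ∈ spectrum c u := by rw [hs]; exact ⟨h1, h2⟩
    rwa [spectrum_eq_image] at this
  · obtain ⟨v, hv⟩ := ht 1 le_rfl ht1
    exact ⟨v, by have := hv.1; omega⟩
  · obtain ⟨v, hv⟩ := ht t ht1 le_rfl
    exact ⟨v, le_antisymm (hle v) hv.2⟩

/-- A dual feasible solution `y` of the packing problem bounds the number of colors. -/
theorem IsIntervalColoring.le_of_dual {n t t' D : ℕ} {c : (K (2 * n)).EdgeLabeling ℕ}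
    (h : IsIntervalColoring c t') (hn : 1 ≤ n) (y : ℕ → ℕ)
    (hy : ∀ j ∈ Finset.Ico 1 n, D ≤ ∑ i ∈ Finset.range n, y i * IsShiftColoring.weight n i j)
    (hb : ∑ i ∈ Finset.range n, y i * IsShiftColoring.capacity n i < D * (t + 2 - 2 * n)) :
    t' ≤ t := by
  obtain ⟨s, hs, ⟨u₀, h₀⟩, ⟨u₁, h₁⟩⟩ := h.exists_isShiftColoring (by omega)
  -- Here `t + 2 - 2 * n` is one more than the target shift `t - (2 * n - 1)`; strictness lets a
  -- fractional dual bound be rounded down.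
  have := Nat.lt_of_mul_lt_mul_left
    ((hs.mul_shift_le (u₁ := u₁) hn (by simp) h₀ rfl y hy).trans_lt hb)
  omega

end FromEdgeLabeling

/-! ### Explicit colorings and dual certificates -/

/-- A symmetric function on `ℕ` whose rows contain intervals of colors defines an interval coloring
of `K m`. -/
theorem mem_colorCounts_K {m t : ℕ} (f : ℕ → ℕ → ℕ) (symm : ∀ u v, f u v = f v u)
    (row : ∀ v < m, ∃ a < t, a + (m - 1) ≤ t ∧
      ∀ k < m - 1, ∃ u < m, u ≠ v ∧ f v u = a + 1 + k)
    (all : ∀ k < t, ∃ v < m, ∃ u < v, f v u = k + 1) : t ∈ colorCounts (K m) := by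
  let c : (K m).EdgeLabeling ℕ := fun e =>
    Sym2.lift ⟨fun u v : Fin m => f u v, fun u v => symm u v⟩ e.1
  have hc : ∀ u v : Fin m, u ≠ v → edgeColor c u v = f u v := fun u v huv => edgeColor_eq huv
  have key : ∀ v : Fin m, ∃ a, a + (m - 1) ≤ t ∧
      Set.InjOn (edgeColor c v) {u | u ≠ v} ∧ spectrum c v = Set.Icc (a + 1) (a + (m - 1)) := by
    intro v
    obtain ⟨a, -, ha, hk⟩ := row v v.2
    have hsub : Finset.Icc (a + 1) (a + (m - 1)) ⊆ (Finset.univ.erase v).image (edgeColor c v) := by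
      intro k hk'
      rw [Finset.mem_Icc] at hk'
      obtain ⟨u, hu, hne, huk⟩ := hk (k - (a + 1)) (by omega)
      have hne' : (⟨u, hu⟩ : Fin m) ≠ v := fun e => hne (by rw [← e])
      refine Finset.mem_image.2 ⟨⟨u, hu⟩, by simpa using hne', ?_⟩
      rw [hc _ _ hne'.symm, huk]
      omega
    have hcard : (Finset.univ.erase v).card = (Finset.Icc (a + 1) (a + (m - 1))).card := by
      simp
    -- Pigeonhole: `m - 1` edges realize `m - 1` prescribed colors, so each occurs once and there
    -- are no others. Properness thus need not be checked in the tables.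
    have heq := Finset.eq_of_subset_of_card_le hsub (Finset.card_image_le.trans hcard.le)
    have hinj := Finset.card_image_iff.1 (show ((Finset.univ.erase v).image (edgeColor c v)).card =
      (Finset.univ.erase v).card by rw [← heq, hcard])
    have hset : ((Finset.univ.erase v : Finset (Fin m)) : Set (Fin m)) = {u | u ≠ v} := by
      ext; simp
    rw [hset] at hinj
    refine ⟨a, ha, hinj, ?_⟩
    rw [spectrum_eq_image, ← hset, ← Finset.coe_image, ← heq, Finset.coe_Icc]
  refine ⟨c, ?_, ?_, fun v => ?_⟩
  · rintro e e' hne ⟨v, hv, hv'⟩ heq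
    obtain ⟨e, he⟩ := e
    obtain ⟨e', he'⟩ := e'
    obtain ⟨u, rfl⟩ := Sym2.mem_iff_exists.1 hv
    obtain ⟨u', rfl⟩ := Sym2.mem_iff_exists.1 hv'
    have h1 : v ≠ u := by simpa using he
    have h2 : v ≠ u' := by simpa using he'
    obtain ⟨-, -, hinj, -⟩ := key v
    have : u = u' := hinj h1.symm h2.symm (by rw [edgeColor_eq h1, edgeColor_eq h2]; exact heq)
    subst this
    exact hne rfl
  · ext k
    constructor
    · rintro ⟨⟨⟨u, v⟩, he⟩, rfl⟩
      obtain ⟨a, ha, -, hs⟩ := key u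
      have : c ⟨s(u, v), he⟩ ∈ spectrum c u := ⟨_, Sym2.mem_mk_left u v, rfl⟩
      rw [hs, Set.mem_Icc] at this
      exact ⟨le_trans (by omega) this.1, this.2.trans ha⟩
    · rintro ⟨h1, h2⟩
      obtain ⟨v, hv, u, hu, hk⟩ := all (k - 1) (by omega)
      have hne : (⟨v, hv⟩ : Fin m) ≠ ⟨u, hu.trans hv⟩ := fun e => by simp at e; omega
      exact ⟨⟨s(_, _), hne⟩, (edgeColor_eq (c := c) hne).symm.trans (by rw [hc _ _ hne, hk]; omega)⟩
  · obtain ⟨a, -, -, hs⟩ := key v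
    exact ⟨_, _, hs⟩

/-- The color of the edge `u v` in a lower triangular table. -/
def tableColor (A : List (List ℕ)) (u v : ℕ) : ℕ := (A.getD (max u v) []).getD (min u v) 0

theorem tableColor_comm (A : List (List ℕ)) (u v : ℕ) : tableColor A u v = tableColor A v u := by
  rw [tableColor, tableColor, max_comm, min_comm]

/-- Lower triangles of extremal interval colorings of `K 2, K 4, …, K 24`: row `v` of the `n`-th
table lists the colors of the edges from the vertex `v` to `0, …, v - 1`. -/
def extremalTable : ℕ → List (List ℕ)
  | 1 => [[], [1]]
  | 2 => [[], [1], [2, 3], [3, 2, 4]]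
  | 3 => [[], [1], [5, 2], [2, 4, 3], [4, 3, 6, 5], [3, 5, 4, 6, 7]]
  | 4 => [[], [1], [3, 2], [2, 3, 4], [7, 4, 6, 5], [4, 7, 5, 6, 8], [6, 5, 7, 8, 10, 9],
      [5, 6, 8, 7, 9, 10, 11]]
  | 5 => [[], [1], [2, 3], [9, 2, 4], [3, 4, 5, 6], [4, 5, 8, 3, 7], [5, 9, 6, 7, 8, 10],
      [8, 6, 7, 5, 10, 9, 11], [6, 7, 10, 8, 9, 11, 12, 13], [7, 8, 9, 10, 11, 6, 13, 12, 14]]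
  | 6 => [[], [1], [2, 5], [4, 2, 3], [5, 3, 4, 6], [3, 4, 6, 5, 7], [7, 6, 8, 9, 11, 10],
      [6, 7, 9, 8, 10, 11, 12], [9, 11, 10, 7, 8, 12, 13, 15], [10, 9, 7, 11, 12, 8, 16, 13, 14],
      [8, 10, 11, 12, 9, 13, 14, 16, 17, 15], [11, 8, 12, 10, 13, 9, 15, 14, 16, 17, 18]]
  | 7 => [[], [4], [1, 5], [3, 1, 2], [2, 3, 4, 6], [5, 2, 3, 4, 7], [13, 7, 12, 5, 8, 6],
      [8, 11, 6, 7, 5, 10, 9], [7, 6, 9, 13, 11, 8, 10, 12], [6, 8, 7, 10, 12, 9, 11, 13, 14],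
      [9, 10, 8, 12, 13, 11, 14, 15, 17, 16], [10, 13, 11, 8, 9, 12, 15, 14, 16, 17, 18],
      [11, 12, 13, 9, 10, 14, 17, 16, 15, 18, 20, 19],
      [12, 9, 10, 11, 14, 13, 16, 17, 18, 15, 19, 20, 21]]
  | 8 => [[], [1], [2, 3], [3, 2, 4], [4, 5, 7, 6], [5, 4, 6, 7, 8], [6, 7, 5, 8, 10, 9],
      [7, 6, 8, 5, 9, 10, 11], [8, 9, 10, 12, 11, 14, 15, 13], [9, 8, 11, 10, 12, 15, 13, 14, 16],
      [10, 11, 9, 14, 13, 16, 12, 15, 18, 17], [11, 10, 12, 9, 15, 13, 14, 16, 17, 18, 19],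
      [12, 13, 14, 15, 16, 11, 17, 18, 20, 19, 21, 22],
      [13, 12, 15, 11, 14, 18, 16, 17, 19, 20, 22, 21, 23],
      [14, 15, 13, 16, 18, 17, 19, 12, 21, 22, 20, 23, 24, 25],
      [15, 14, 16, 13, 17, 12, 18, 19, 22, 21, 23, 20, 25, 24, 26]]
  | 9 => [[], [2], [3, 1], [1, 3, 2], [6, 7, 4, 5], [7, 4, 5, 6, 8], [5, 6, 8, 4, 10, 9],
      [4, 5, 6, 8, 9, 11, 7], [11, 8, 7, 9, 12, 10, 14, 17], [8, 9, 10, 7, 11, 13, 16, 12, 15],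
      [9, 14, 11, 16, 15, 17, 12, 10, 13, 20], [13, 10, 9, 11, 16, 12, 15, 14, 19, 17, 18],
      [12, 11, 16, 10, 17, 20, 13, 15, 18, 14, 19, 21],
      [10, 12, 17, 14, 13, 15, 11, 18, 16, 19, 22, 20, 23],
      [15, 13, 14, 12, 19, 18, 17, 16, 20, 22, 23, 25, 24, 21],
      [16, 15, 12, 17, 20, 14, 19, 13, 21, 18, 25, 23, 22, 24, 26],
      [14, 17, 13, 15, 18, 16, 20, 19, 22, 23, 21, 24, 25, 26, 28, 27],
      [17, 16, 15, 13, 14, 19, 18, 20, 23, 21, 24, 22, 26, 25, 27, 28, 29]]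
  | 10 => [[], [1], [2, 3], [3, 2, 4], [4, 5, 7, 8], [5, 4, 9, 6, 3], [6, 7, 5, 9, 10, 8],
      [7, 6, 8, 5, 9, 10, 11], [8, 9, 10, 7, 6, 11, 13, 12], [9, 8, 6, 10, 11, 7, 12, 13, 14],
      [10, 11, 19, 12, 16, 13, 14, 17, 18, 15], [11, 10, 12, 13, 14, 16, 18, 15, 17, 19, 20],
      [12, 13, 11, 14, 19, 17, 16, 20, 15, 18, 24, 21],
      [13, 12, 14, 11, 18, 19, 15, 16, 20, 17, 21, 23, 22],
      [14, 15, 13, 20, 12, 18, 17, 19, 16, 21, 23, 22, 25, 27],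
      [15, 14, 17, 16, 13, 12, 19, 18, 21, 20, 22, 24, 23, 26, 28],
      [16, 17, 20, 18, 21, 15, 22, 14, 19, 23, 25, 26, 27, 28, 24, 29],
      [17, 16, 18, 19, 15, 14, 20, 21, 23, 22, 26, 25, 28, 24, 29, 27, 30],
      [18, 19, 16, 15, 17, 20, 21, 23, 22, 24, 27, 28, 26, 29, 30, 25, 32, 31],
      [19, 18, 15, 17, 20, 21, 23, 22, 24, 16, 28, 27, 29, 25, 26, 30, 31, 32, 33]]
  | 11 => [[], [1], [2, 3], [5, 2, 4], [4, 5, 8, 3], [3, 4, 5, 7, 6], [6, 7, 12, 9, 10, 8],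
      [7, 6, 10, 8, 12, 9, 11], [8, 9, 6, 10, 7, 11, 15, 13], [9, 8, 7, 6, 11, 10, 13, 14, 12],
      [10, 11, 21, 13, 9, 12, 14, 16, 20, 15], [11, 10, 9, 12, 14, 13, 19, 15, 16, 17, 18],
      [12, 13, 11, 14, 15, 21, 20, 19, 18, 16, 17, 22],
      [13, 12, 14, 11, 16, 15, 21, 18, 17, 19, 22, 20, 23],
      [14, 15, 13, 16, 20, 23, 22, 17, 19, 18, 24, 21, 26, 25],
      [15, 14, 16, 17, 13, 19, 18, 21, 22, 20, 25, 23, 24, 26, 31],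
      [16, 17, 15, 18, 23, 20, 26, 22, 14, 21, 19, 25, 27, 24, 28, 29],
      [17, 16, 18, 15, 19, 14, 24, 20, 21, 22, 23, 26, 25, 27, 29, 28, 30],
      [18, 19, 20, 21, 22, 16, 17, 25, 23, 24, 26, 27, 28, 29, 30, 33, 32, 31],
      [19, 18, 22, 20, 21, 17, 16, 26, 25, 23, 27, 24, 29, 28, 33, 30, 31, 32, 34],
      [20, 21, 19, 22, 17, 18, 23, 24, 26, 25, 28, 29, 30, 31, 32, 27, 33, 34, 35, 36],
      [21, 20, 17, 19, 18, 22, 25, 23, 24, 26, 29, 28, 31, 30, 27, 32, 34, 33, 36, 35, 37]]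
  | 12 => [[], [1], [4, 2], [2, 3, 5], [5, 4, 3, 6], [3, 5, 6, 4, 7], [6, 11, 7, 8, 9, 10],
      [7, 6, 8, 9, 10, 11, 12], [10, 7, 9, 12, 11, 8, 13, 15], [8, 10, 11, 7, 12, 9, 16, 13, 14],
      [11, 9, 12, 10, 8, 13, 14, 16, 17, 15], [9, 8, 10, 11, 13, 12, 15, 14, 16, 17, 18],
      [13, 12, 14, 15, 16, 18, 19, 17, 20, 22, 23, 21],
      [12, 15, 16, 13, 18, 14, 17, 19, 22, 21, 20, 23, 24],
      [16, 14, 13, 20, 17, 15, 24, 22, 23, 18, 21, 19, 28, 25],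
      [15, 13, 18, 16, 14, 17, 23, 21, 19, 20, 22, 24, 25, 26, 27],
      [14, 16, 17, 21, 15, 23, 22, 18, 24, 25, 19, 20, 26, 27, 29, 28],
      [17, 19, 15, 14, 24, 16, 18, 20, 21, 23, 25, 22, 27, 28, 26, 29, 30],
      [19, 17, 22, 18, 20, 21, 27, 23, 25, 28, 24, 26, 29, 34, 32, 30, 33, 31],
      [23, 22, 24, 17, 21, 20, 26, 25, 18, 19, 27, 28, 32, 29, 30, 31, 34, 33, 35],
      [22, 18, 20, 23, 25, 19, 21, 28, 27, 24, 26, 29, 33, 30, 35, 32, 31, 34, 36, 37],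
      [18, 23, 21, 19, 22, 25, 20, 24, 26, 29, 28, 27, 30, 31, 34, 33, 35, 32, 39, 36, 38],
      [20, 21, 19, 24, 23, 22, 25, 27, 28, 26, 29, 30, 31, 32, 33, 34, 36, 35, 38, 39, 40, 37],
      [21, 20, 23, 22, 19, 24, 28, 26, 29, 27, 30, 25, 34, 33, 31, 35, 32, 36, 37, 38, 39, 40, 41]]
  | _ => []

/-- The table `extremalTable n` has the greatest number of colors, as certified by `y`. -/
theorem isGreatest_colorCounts_K (n t D : ℕ) (y : List ℕ)
    (row : ∀ v < 2 * n, ∃ a < t, a + (2 * n - 1) ≤ t ∧ ∀ k < 2 * n - 1, ∃ u < 2 * n, u ≠ v ∧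
      tableColor (extremalTable n) v u = a + 1 + k)
    (all : ∀ k < t, ∃ v < 2 * n, ∃ u < v, tableColor (extremalTable n) v u = k + 1)
    (dual : 1 ≤ n ∧ (∀ j ∈ Finset.Ico 1 n,
        D ≤ ∑ i ∈ Finset.range n, y.getD i 0 * IsShiftColoring.weight n i j) ∧
      ∑ i ∈ Finset.range n, y.getD i 0 * IsShiftColoring.capacity n i < D * (t + 2 - 2 * n)) :
    IsGreatest (colorCounts (K (2 * n))) t ∧ W (K (2 * n)) = t := by
  have h : IsGreatest (colorCounts (K (2 * n))) t :=
    ⟨mem_colorCounts_K _ (tableColor_comm _) row all,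
      fun _ ⟨_, hc⟩ => hc.le_of_dual dual.1 _ dual.2.1 dual.2.2⟩
  exact ⟨h, h.csSup_eq⟩

theorem isGreatest_colorCounts_K_of_le_twelve :
    ∀ p ∈ ([(1, 1), (2, 4), (3, 7), (4, 11), (5, 14), (6, 18), (7, 21), (8, 26), (9, 29),
          (10, 33), (11, 37), (12, 41)] : List (ℕ × ℕ)),
        IsGreatest (colorCounts (K (2 * p.1))) p.2 ∧ W (K (2 * p.1)) = p.2 := by
  intro p hp
  fin_cases hp
  · exact isGreatest_colorCounts_K 1 1 1 [0]
      (by decide +kernel) (by decide +kernel) (by decide +kernel)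
  · exact isGreatest_colorCounts_K 2 4 1 [0, 1]
      (by decide +kernel) (by decide +kernel) (by decide +kernel)
  · exact isGreatest_colorCounts_K 3 7 1 [0, 1, 1]
      (by decide +kernel) (by decide +kernel) (by decide +kernel)
  · exact isGreatest_colorCounts_K 4 11 2 [0, 1, 1, 1]
      (by decide +kernel) (by decide +kernel) (by decide +kernel)
  · exact isGreatest_colorCounts_K 5 14 3 [0, 2, 1, 1, 2]
      (by decide +kernel) (by decide +kernel) (by decide +kernel)
  · exact isGreatest_colorCounts_K 6 18 2 [0, 1, 1, 0, 1, 1]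
      (by decide +kernel) (by decide +kernel) (by decide +kernel)
  · exact isGreatest_colorCounts_K 7 21 7 [0, 4, 2, 1, 1, 2, 4]
      (by decide +kernel) (by decide +kernel) (by decide +kernel)
  · exact isGreatest_colorCounts_K 8 26 4 [0, 2, 1, 0, 1, 0, 1, 2]
      (by decide +kernel) (by decide +kernel) (by decide +kernel)
  · exact isGreatest_colorCounts_K 9 29 7 [0, 4, 2, 0, 1, 1, 0, 2, 4]
      (by decide +kernel) (by decide +kernel) (by decide +kernel)
  · exact isGreatest_colorCounts_K 10 33 6 [0, 3, 2, 0, 1, 0, 1, 0, 2, 3]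
      (by decide +kernel) (by decide +kernel) (by decide +kernel)
  -- The dual value is `502`, so the largest shift is at most `⌊502 / 31⌋ = 16`, and `16 + 21 = 37`.
  -- As in the other cases, `D` is a common denominator of a rational dual vector.
  · exact isGreatest_colorCounts_K 11 37 31 [0, 16, 8, 2, 4, 1, 1, 4, 2, 8, 16]
      (by decide +kernel) (by decide +kernel) (by decide +kernel)
  · exact isGreatest_colorCounts_K 12 41 4 [0, 2, 1, 0, 1, 0, 0, 0, 1, 0, 1, 2]
      (by decide +kernel) (by decide +kernel) (by decide +kernel)

theorem conjecturedValue_eleven : conjecturedValue 11 = 36 := by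
  have h : Nat.log 2 11 = 3 := by rw [Nat.log_eq_iff] <;> norm_num
  rw [conjecturedValue, h]
  norm_num

end IntervalColoring


theorem mainTheorem8 :
    (∀ p ∈ ([(1, 1), (2, 4), (3, 7), (4, 11), (5, 14), (6, 18), (7, 21), (8, 26), (9, 29),
          (10, 33), (11, 37), (12, 41)] : List (ℕ × ℕ)),
        IsGreatest (IntervalColoring.colorCounts (IntervalColoring.K (2 * p.1))) p.2 ∧
          IntervalColoring.W (IntervalColoring.K (2 * p.1)) = p.2) ∧
      IntervalColoring.W (IntervalColoring.K 22) = 37 ∧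
      IntervalColoring.conjecturedValue 11 = 36 ∧
      ¬ ∀ n : ℕ, 1 ≤ n →
        (IntervalColoring.W (IntervalColoring.K (2 * n)) : ℤ) =
          IntervalColoring.conjecturedValue n := by
  have h11 := (IntervalColoring.isGreatest_colorCounts_K_of_le_twelve (11, 37) (by simp)).2
  refine ⟨IntervalColoring.isGreatest_colorCounts_K_of_le_twelve, h11,
    IntervalColoring.conjecturedValue_eleven, fun h => ?_⟩
  have h' := h 11 (by norm_num)
  rw [h11, IntervalColoring.conjecturedValue_eleven] at h'
  norm_num at h'
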